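/- Let $n$ be a nonnegative integer, $d_1,\dots,d_n$ nonnegative integers, and for each $i\in\{1,\dots,n\}$ let $C_i\in\mathcal M_{d_i}$ be a complex $d_i\times d_i$ matrix. Let $$C_{(i)}:=\mathbb 1_{d_1}\otimes\cdots\otimes\mathbb 1_{d_{i-1}}\otimes C_i\otimes\mathbb 1_{d_{i+1}}\otimes\cdots\otimes\mathbb 1_{d_n}$$ be the embedding of $C_i$ on the $i$-th tensor factor of $\mathcal M_{d_1}\otimes\cdots\otimes\mathcal M_{d_n}=\mathcal M_N$, where $N=\prod_{i=1}^n d_i$. For $X\in\mathcal M_N$ write $|X|:=(X^*X)^{1/2}$ and let $\sigma_1(X)\ge\dots\ge\sigma_N(X)$ be the singular values of $X$, in decreasing order and counted with multiplicity. Then the vector of singular values of the Kronecker sum $\sum_i C_{(i)}$ is weakly submajorized by that of $\sum_i |C_{(i)}|$: $$\Big(\sigma_j\Big(\sum_{i=1}^n C_{(i)}\Big)\Big)_{j=1}^N\prec_{\mathrm w}\Big(\sigma_j\Big(\sum_{i=1}^n |C_{(i)}|\Big)\Big)_{j=1}^N,$$ where for $x,y\in\mathbb R^N$ the relation $x\prec_{\mathrm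 w}y$ means that for every $k\in\{1,\dots,N\}$ the sum of the $k$ largest components of $x$ is at most the sum of the $k$ largest components of $y$. -/

import Mathlib

open scoped Matrix MatrixOrder

noncomputable section

/-- The vector `σ₁(A) ≥ σ₂(A) ≥ … ≥ σ_N(A)` of all singular values of a complex `N × N` matrix,
in decreasing order, repeated according to multiplicity and including zeros. -/
def singularValueVector {m : Type*} [Fintype m] [DecidableEq m] (A : Matrix m m ℂ) :
    Fin (Fintype.card m) → ℝ :=
  fun j => (Matrix.toEuclideanLin A).singularValues (j : ℕ)

/-- The absolute value `|A| = (Aᴴ A)^{1/2}` of a complex matrix. -/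
def matrixAbs {m : Type*} [Fintype m] [DecidableEq m] (A : Matrix m m ℂ) : Matrix m m ℂ :=
  CFC.sqrt (Aᴴ * A)

/-- The decreasing rearrangement `x↓` of a real vector `x`. -/
def decreasingRearrangement {N : ℕ} (x : Fin N → ℝ) : Fin N → ℝ :=
  x ∘ Tuple.sort (fun i => -x i)

/-- Weak submajorization `x ≺_w y`: for every `k ≤ N`, the sum of the `k` largest components
of `x` is at most the sum of the `k` largest components of `y`. -/
def WeaklySubmajorizedBy {N : ℕ} (x y : Fin N → ℝ) : Prop :=
  ∀ k : ℕ, k ≤ N →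
    ∑ j ∈ Finset.univ.filter (fun j : Fin N => (j : ℕ) < k), decreasingRearrangement x j ≤
      ∑ j ∈ Finset.univ.filter (fun j : Fin N => (j : ℕ) < k), decreasingRearrangement y j

/-- The tensor (Kronecker) product `A₁ ⊗ ⋯ ⊗ A_n`, with rows and columns indexed by
multi-indices `(a₁, …, a_n)`. -/
def tensorMatrix {n : ℕ} {d : Fin n → ℕ}
    (A : (i : Fin n) → Matrix (Fin (d i)) (Fin (d i)) ℂ) :
    Matrix ((i : Fin n) → Fin (d i)) ((i : Fin n) → Fin (d i)) ℂ :=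
  Matrix.of fun a b => ∏ i, A i (a i) (b i)

/-- The embedding `C_(i) = 1 ⊗ ⋯ ⊗ C ⊗ ⋯ ⊗ 1` of a matrix `C` on the `i`-th tensor factor. -/
def embedFactor {n : ℕ} {d : Fin n → ℕ} (i : Fin n) (C : Matrix (Fin (d i)) (Fin (d i)) ℂ) :
    Matrix ((i : Fin n) → Fin (d i)) ((i : Fin n) → Fin (d i)) ℂ :=
  tensorMatrix (Function.update (fun _ => 1) i C)

end

/-! Write `C i = U i * |C i|` with `U i` unitary, and let `P i`, `V i` be the embeddings of `|C i|`,
`U i`. For singular vectors `b j`, `c j` of `∑ V i P i`, the `j`-th singular value is `∑ i, Re ⟪(V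
i)* c j, P i (b j)⟫`, and positivity of `P i` bounds it by the mean of the quadratic forms of `P i`
at `(V i)* c j` and at `b j`. The tensor structure enters once: `V i P i (V i)* = U P i U*` for the
single unitary `U = U 1 ⊗ ⋯ ⊗ U n`. Both means are thus taken of `Q = ∑ P i` over orthonormal
families, `U* c j` and `b j`, and Ky Fan's inequality for `Q` bounds each
(`LinearMap.sum_singularValues_sum_le`). -/

theorem decreasingRearrangement_of_antitone {N : ℕ} {x : Fin N → ℝ} (hx : Antitone x) :
    decreasingRearrangement x = x := by
  have h : Monotone fun i => -x i := fun i j hij => neg_le_neg (hx hij)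
  rw [decreasingRearrangement, Tuple.sort_eq_refl_iff_monotone.2 h]
  rfl

/-- A weighted sum of a decreasing sequence with weights in `[0, 1]` of total mass `k` is at most
the sum of its first `k` terms. -/
theorem sum_mul_le_sum_filter_lt {N k : ℕ} {s : ℕ → ℝ} (hs : Antitone s) {w : Fin N → ℝ}
    (hw₀ : ∀ m, 0 ≤ w m) (hw₁ : ∀ m, w m ≤ 1)
    (hw : ∑ m, w m = (Finset.univ.filter fun j : Fin N => (j : ℕ) < k).card) :
    ∑ m : Fin N, s m * w m ≤ ∑ m ∈ Finset.univ.filter (fun j : Fin N => (j : ℕ) < k), s m := by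
  -- After subtracting the threshold `s k` the inequality holds term by term; equal total masses
  -- cancel the shift.
  have h : ∑ m : Fin N, (s m - s k) * w m ≤
      ∑ m ∈ Finset.univ.filter (fun j : Fin N => (j : ℕ) < k), (s m - s k) := by
    rw [Finset.sum_filter]
    refine Finset.sum_le_sum fun m _ => ?_
    split_ifs with hm
    · exact mul_le_of_le_one_right (sub_nonneg.2 (hs hm.le)) (hw₁ m)
    · exact mul_nonpos_of_nonpos_of_nonneg (sub_nonpos.2 (hs (not_lt.1 hm))) (hw₀ m)
  simp only [sub_mul, Finset.sum_sub_distrib, ← Finset.mul_sum, hw, Finset.sum_const,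
    nsmul_eq_mul] at h
  linarith

/-- Expand `0 ≤ ⟪u - v, T (u - v)⟫`. -/
theorem LinearMap.IsPositive.re_inner_le {E : Type*} [NormedAddCommGroup E]
    [InnerProductSpace ℂ E] {T : E →ₗ[ℂ] E} (hT : T.IsPositive) (u v : E) :
    (inner ℂ u (T v)).re ≤ ((inner ℂ u (T u)).re + (inner ℂ v (T v)).re) / 2 := by
  have h : 0 ≤ (inner ℂ (u - v) (T (u - v))).re := hT.re_inner_nonneg_right (u - v)
  have hsymm : (inner ℂ v (T u)).re = (inner ℂ u (T v)).re := by
    rw [← hT.isSymmetric v u, ← inner_conj_symm, Complex.conj_re]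
  simp only [map_sub, inner_sub_left, inner_sub_right, Complex.sub_re, hsymm] at h
  linarith

/-! ### Singular values and Ky Fan sums of operators. -/

section Operator

variable {E : Type*} [NormedAddCommGroup E] [InnerProductSpace ℂ E] [FiniteDimensional ℂ E]

/-- Singular value decomposition of an endomorphism. -/
theorem LinearMap.exists_orthonormalBasis_apply_eq_singularValues_smul {N : ℕ}
    (hN : Module.finrank ℂ E = N) (T : E →ₗ[ℂ] E) :
    ∃ b c : OrthonormalBasis (Fin N) ℂ E, ∀ j, T (b j) = (T.singularValues j : ℂ) • c j := by
  classical
  set hT := T.isSymmetric_adjoint_comp_self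
  set b := hT.eigenvectorBasis hN
  have hb : ∀ i j, inner ℂ (T (b i)) (T (b j)) =
      if i = j then ((T.singularValues j : ℂ)) ^ 2 else 0 := by
    intro i j
    rw [← LinearMap.adjoint_inner_right, ← LinearMap.comp_apply, hT.apply_eigenvectorBasis hN j,
      inner_smul_right, orthonormal_iff_ite.1 b.orthonormal i j, ← T.sq_singularValues_fin hN]
    split_ifs <;> simp
  -- Orthonormal only on the nonzero singular values; the rest of `c` comes from extending to a
  -- basis.
  let v : Fin N → E := fun j => ((T.singularValues j : ℂ))⁻¹ • T (b j)
  let s : Set (Fin N) := {j | T.singularValues j ≠ 0}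
  have hv : Orthonormal ℂ (s.domRestrict v) := by
    rw [orthonormal_iff_ite]
    rintro ⟨i, hi⟩ ⟨j, hj⟩
    have hj' : (T.singularValues j : ℂ) ≠ 0 := by exact_mod_cast hj
    simp only [Set.domRestrict_apply, v, inner_smul_left, inner_smul_right, hb, Subtype.mk.injEq]
    split_ifs with hij
    · subst hij
      simp only [map_inv₀, Complex.conj_ofReal]
      field_simp
    · simp
  obtain ⟨c, hc⟩ := hv.exists_orthonormalBasis_extension_of_card_eq (by simpa using hN)
  refine ⟨b, c, fun j => ?_⟩
  by_cases hj : T.singularValues j = 0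
  · have := hb j j
    simp only [hj, if_true] at this
    simpa [hj] using this
  · have hj' : (T.singularValues j : ℂ) ≠ 0 := by exact_mod_cast hj
    rw [hc j hj]
    simp [v, smul_smul, hj']

/-- Ky Fan's inequality for the sum of the `k` largest singular values. -/
theorem LinearMap.sum_re_inner_le_sum_singularValues {N : ℕ}
    (hN : Module.finrank ℂ E = N) (T : E →ₗ[ℂ] E) {u v : Fin N → E}
    (hu : Orthonormal ℂ u) (hv : Orthonormal ℂ v) (k : ℕ) :
    ∑ j ∈ Finset.univ.filter (fun j : Fin N => (j : ℕ) < k), (inner ℂ (u j) (T (v j))).re ≤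
      ∑ j ∈ Finset.univ.filter (fun j : Fin N => (j : ℕ) < k), T.singularValues j := by
  obtain ⟨b, c, hbc⟩ := T.exists_orthonormalBasis_apply_eq_singularValues_smul hN
  set S := Finset.univ.filter fun j : Fin N => (j : ℕ) < k
  -- Weight falling on the `m`-th singular value: at most 1 by Bessel, of total mass `S.card` by
  -- Parseval.
  let w : Fin N → ℝ := fun m =>
    ∑ j ∈ S, (‖inner ℂ (u j) (c m)‖ ^ 2 + ‖inner ℂ (v j) (b m)‖ ^ 2) / 2
  have hle : ∀ j : Fin N, (inner ℂ (u j) (T (v j))).re ≤ ∑ m : Fin N, T.singularValues m *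
      ((‖inner ℂ (u j) (c m)‖ ^ 2 + ‖inner ℂ (v j) (b m)‖ ^ 2) / 2) := by
    intro j
    have h : inner ℂ (u j) (T (v j)) =
        ∑ m : Fin N, (T.singularValues m : ℂ) * (inner ℂ (u j) (c m) * inner ℂ (b m) (v j)) := by
      conv_lhs => rw [← b.sum_repr' (v j)]
      simp only [map_sum, map_smul, hbc, inner_sum, inner_smul_right]
      exact Finset.sum_congr rfl fun m _ => by ring
    rw [h, Complex.re_sum]
    refine Finset.sum_le_sum fun m _ => ?_
    rw [Complex.re_ofReal_mul]
    refine mul_le_mul_of_nonneg_left ?_ (T.singularValues_nonneg m)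
    refine (Complex.re_le_norm _).trans ?_
    rw [norm_mul, norm_inner_symm (b m)]
    nlinarith [sq_nonneg (‖inner ℂ (u j) (c m)‖ - ‖inner ℂ (v j) (b m)‖)]
  calc ∑ j ∈ S, (inner ℂ (u j) (T (v j))).re
      ≤ ∑ j ∈ S, ∑ m : Fin N, T.singularValues m *
          ((‖inner ℂ (u j) (c m)‖ ^ 2 + ‖inner ℂ (v j) (b m)‖ ^ 2) / 2) :=
        Finset.sum_le_sum fun j _ => hle j
    _ = ∑ m : Fin N, T.singularValues m * w m := by
        rw [Finset.sum_comm]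
        simp only [w, Finset.mul_sum]
    _ ≤ _ := by
        refine sum_mul_le_sum_filter_lt T.singularValues_antitone (fun m => ?_) (fun m => ?_) ?_
        · exact Finset.sum_nonneg fun j _ => by positivity
        · have h₁ := hu.sum_inner_products_le (c m) (s := S)
          have h₂ := hv.sum_inner_products_le (b m) (s := S)
          simp only [OrthonormalBasis.norm_eq_one, one_pow] at h₁ h₂
          simp only [w, ← Finset.sum_div, Finset.sum_add_distrib]
          linarith
        · simp only [w]
          rw [Finset.sum_comm]
          simp only [← Finset.sum_div, Finset.sum_add_distrib,
            OrthonormalBasis.sum_sq_norm_inner_left, hu.1, hv.1]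
          simp [S]

/-- If `Tᵢ = Vᵢ Pᵢ` with `Pᵢ` positive, and the operators `Vᵢ Pᵢ Vᵢ*` are simultaneously conjugate
to the `Pᵢ` by one operator `U` with isometric adjoint, then the Ky Fan norms of `∑ Tᵢ` are at most
those of `∑ Pᵢ`. -/
theorem LinearMap.sum_singularValues_sum_le {N : ℕ} (hN : Module.finrank ℂ E = N)
    {ι : Type*} [Fintype ι] {P V : ι → E →ₗ[ℂ] E} {U : E →ₗ[ℂ] E}
    (hP : ∀ i, (P i).IsPositive) (hU : U ∘ₗ U.adjoint = LinearMap.id)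
    (hconj : ∀ i, V i ∘ₗ P i ∘ₗ (V i).adjoint = U ∘ₗ P i ∘ₗ U.adjoint) (k : ℕ) :
    ∑ j ∈ Finset.univ.filter (fun j : Fin N => (j : ℕ) < k),
        (∑ i, V i ∘ₗ P i).singularValues j ≤
      ∑ j ∈ Finset.univ.filter (fun j : Fin N => (j : ℕ) < k), (∑ i, P i).singularValues j := by
  obtain ⟨b, c, hbc⟩ :=
    (∑ i, V i ∘ₗ P i).exists_orthonormalBasis_apply_eq_singularValues_smul hN
  set Q := ∑ i, P i
  have hu : Orthonormal ℂ fun j => U.adjoint (c j) := by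
    rw [orthonormal_iff_ite]
    intro i j
    rw [LinearMap.adjoint_inner_left, ← LinearMap.comp_apply, hU, LinearMap.id_apply,
      orthonormal_iff_ite.1 c.orthonormal]
  have h : ∀ j : Fin N, (∑ i, V i ∘ₗ P i).singularValues j ≤
      ((inner ℂ (U.adjoint (c j)) (Q (U.adjoint (c j)))).re +
        (inner ℂ (b j) (Q (b j))).re) / 2 := by
    intro j
    have h₁ : (∑ i, V i ∘ₗ P i).singularValues j =
        ∑ i, (inner ℂ ((V i).adjoint (c j)) (P i (b j))).re := by
      have h₂ : inner ℂ (c j) ((∑ i, V i ∘ₗ P i) (b j)) =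
          ((∑ i, V i ∘ₗ P i).singularValues j : ℂ) := by
        rw [hbc, inner_smul_right, orthonormal_iff_ite.1 c.orthonormal]
        simp
      rw [← Complex.ofReal_re ((∑ i, V i ∘ₗ P i).singularValues j), ← h₂]
      simp only [LinearMap.sum_apply, inner_sum, Complex.re_sum, LinearMap.comp_apply,
        LinearMap.adjoint_inner_left]
    -- The vectors `(V i)* c j` vary with `i`; `hconj` trades them for one vector, so the forms add
    -- up to that of `Q`.
    have h₃ : ∀ i, inner ℂ (U.adjoint (c j)) (P i (U.adjoint (c j))) =
        inner ℂ ((V i).adjoint (c j)) (P i ((V i).adjoint (c j))) := by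
      intro i
      have := congrArg (fun T : E →ₗ[ℂ] E => inner ℂ (c j) (T (c j))) (hconj i)
      simpa only [LinearMap.comp_apply, ← LinearMap.adjoint_inner_left] using this.symm
    rw [h₁]
    simp only [Q, LinearMap.sum_apply, inner_sum, Complex.re_sum, h₃]
    rw [← Finset.sum_add_distrib, Finset.sum_div]
    exact Finset.sum_le_sum fun i _ => (hP i).re_inner_le _ _
  have hb := Q.sum_re_inner_le_sum_singularValues hN b.orthonormal b.orthonormal k
  have hc := Q.sum_re_inner_le_sum_singularValues hN hu hu k
  refine (Finset.sum_le_sum fun j _ => h j).trans ?_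
  rw [← Finset.sum_div, Finset.sum_add_distrib]
  linarith

end Operator

/-! ### Polar decomposition. -/

section Matrix

open scoped ComplexOrder

variable {m : Type*} [Fintype m] [DecidableEq m]

theorem matrixAbs_posSemidef (A : Matrix m m ℂ) : (matrixAbs A).PosSemidef :=
  Matrix.nonneg_iff_posSemidef.1 (CFC.sqrt_nonneg (Aᴴ * A))

/-- Polar decomposition with a unitary factor. -/
theorem exists_unitary_eq_mul_matrixAbs (A : Matrix m m ℂ) :
    ∃ U ∈ Matrix.unitaryGroup m ℂ, A = U * matrixAbs A := by
  obtain ⟨b, c, hbc⟩ :=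
    (Matrix.toEuclideanLin A).exists_orthonormalBasis_apply_eq_singularValues_smul
      (finrank_euclideanSpace (𝕜 := ℂ) (ι := m))
  let e := (Fintype.equivFin m).symm
  let σ : m → ℂ := fun j => (Matrix.toEuclideanLin A).singularValues (e.symm j)
  let W := (EuclideanSpace.basisFun m ℂ).toBasis.toMatrix (b.reindex e)
  let V := (EuclideanSpace.basisFun m ℂ).toBasis.toMatrix (c.reindex e)
  have hW : W ∈ Matrix.unitaryGroup m ℂ :=
    (EuclideanSpace.basisFun m ℂ).toMatrix_orthonormalBasis_mem_unitary _
  have hV : V ∈ Matrix.unitaryGroup m ℂ :=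
    (EuclideanSpace.basisFun m ℂ).toMatrix_orthonormalBasis_mem_unitary _
  have hWW : Wᴴ * W = 1 := Matrix.mem_unitaryGroup_iff'.1 hW
  have hWW' : W * Wᴴ = 1 := Matrix.mem_unitaryGroup_iff.1 hW
  have hVV : Vᴴ * V = 1 := Matrix.mem_unitaryGroup_iff'.1 hV
  have hAW : A * W = V * Matrix.diagonal σ := by
    ext i j
    have := congrArg (fun x : EuclideanSpace ℂ m => x i) (hbc (e.symm j))
    simp only [Matrix.toLpLin_apply, Matrix.mulVec, dotProduct, PiLp.smul_apply, smul_eq_mul]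
      at this
    rw [Matrix.mul_diagonal, Matrix.mul_apply, mul_comm]
    simpa [W, V, σ, Module.Basis.toMatrix_apply] using this
  have hσ : (Matrix.diagonal σ).PosSemidef := by
    refine Matrix.PosSemidef.diagonal fun j => ?_
    simpa [σ] using (Matrix.toEuclideanLin A).singularValues_nonneg _
  have hA : A = V * Matrix.diagonal σ * Wᴴ := by
    rw [← hAW, Matrix.mul_assoc, hWW', Matrix.mul_one]
  have habs : matrixAbs A = W * Matrix.diagonal σ * Wᴴ := by
    refine CFC.sqrt_unique ?_ (hσ.mul_mul_conjTranspose_same W).nonneg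
    calc W * Matrix.diagonal σ * Wᴴ * (W * Matrix.diagonal σ * Wᴴ)
        = W * Matrix.diagonal σ * (Wᴴ * W) * Matrix.diagonal σ * Wᴴ := by
          simp only [Matrix.mul_assoc]
      _ = W * (Matrix.diagonal σ)ᴴ * (Vᴴ * V) * Matrix.diagonal σ * Wᴴ := by
          rw [hWW, hVV, hσ.isHermitian.eq]
      _ = Aᴴ * A := by
          rw [hA]
          simp only [Matrix.conjTranspose_mul, Matrix.conjTranspose_conjTranspose,
            Matrix.mul_assoc]
  -- Both bases are complete, so this factor is unitary even for singular `A`.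
  refine ⟨V * Wᴴ, mul_mem hV (Unitary.star_mem hW), ?_⟩
  calc A = V * (1 : Matrix m m ℂ) * Matrix.diagonal σ * Wᴴ := by rw [Matrix.mul_one, ← hA]
    _ = V * Wᴴ * matrixAbs A := by
      rw [habs, ← hWW]
      simp only [Matrix.mul_assoc]

theorem decreasingRearrangement_singularValueVector (A : Matrix m m ℂ) :
    decreasingRearrangement (singularValueVector A) = singularValueVector A :=
  decreasingRearrangement_of_antitone fun _ _ h =>
    (Matrix.toEuclideanLin A).singularValues_antitone h

end Matrix

/-! ### Embeddings into tensor factors. -/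

section Tensor

open scoped ComplexOrder

variable {n : ℕ} {d : Fin n → ℕ}

theorem tensorMatrix_mul (A B : (i : Fin n) → Matrix (Fin (d i)) (Fin (d i)) ℂ) :
    tensorMatrix A * tensorMatrix B = tensorMatrix fun i => A i * B i := by
  ext a b
  simp only [tensorMatrix, Matrix.mul_apply, Matrix.of_apply, ← Finset.prod_mul_distrib]
  rw [Finset.prod_univ_sum, Fintype.piFinset_univ]

theorem tensorMatrix_conjTranspose (A : (i : Fin n) → Matrix (Fin (d i)) (Fin (d i)) ℂ) :
    (tensorMatrix A)ᴴ = tensorMatrix fun i => (A i)ᴴ := by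
  ext a b
  simp [tensorMatrix, Matrix.conjTranspose_apply]

theorem tensorMatrix_one :
    tensorMatrix (fun i => (1 : Matrix (Fin (d i)) (Fin (d i)) ℂ)) = 1 := by
  ext a b
  simp only [tensorMatrix, Matrix.of_apply, Matrix.one_apply, Finset.prod_ite_zero,
    Finset.prod_const_one, Finset.mem_univ, true_imp_iff, funext_iff]

theorem embedFactor_mul (i : Fin n) (A B : Matrix (Fin (d i)) (Fin (d i)) ℂ) :
    embedFactor i (A * B) = embedFactor i A * embedFactor i B := by
  rw [embedFactor, embedFactor, embedFactor, tensorMatrix_mul]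
  congr 1
  ext1 j
  obtain rfl | h := eq_or_ne j i <;> simp [*]

theorem embedFactor_conjTranspose (i : Fin n) (A : Matrix (Fin (d i)) (Fin (d i)) ℂ) :
    (embedFactor i A)ᴴ = embedFactor i Aᴴ := by
  rw [embedFactor, embedFactor, tensorMatrix_conjTranspose]
  congr 1
  ext1 j
  obtain rfl | h := eq_or_ne j i <;> simp [*]

theorem embedFactor_posSemidef (i : Fin n) {A : Matrix (Fin (d i)) (Fin (d i)) ℂ}
    (hA : A.PosSemidef) : (embedFactor i A).PosSemidef := by
  obtain ⟨B, rfl⟩ := CStarAlgebra.nonneg_iff_eq_star_mul_self.mp hA.nonneg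
  rw [Matrix.star_eq_conjTranspose, embedFactor_mul, ← embedFactor_conjTranspose]
  exact Matrix.posSemidef_conjTranspose_mul_self _

theorem matrixAbs_embedFactor (i : Fin n) (A : Matrix (Fin (d i)) (Fin (d i)) ℂ) :
    matrixAbs (embedFactor i A) = embedFactor i (matrixAbs A) := by
  refine CFC.sqrt_unique ?_ (embedFactor_posSemidef i (matrixAbs_posSemidef A)).nonneg
  rw [embedFactor_conjTranspose, ← embedFactor_mul, ← embedFactor_mul, matrixAbs,
    CFC.sqrt_mul_sqrt_self _ (Matrix.posSemidef_conjTranspose_mul_self A).nonneg]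

/-- On operators acting on the `i`-th factor, conjugation by `U₁ ⊗ ⋯ ⊗ Uₙ` is conjugation
by `Uᵢ`. -/
theorem tensorMatrix_mul_embedFactor_mul {U : (i : Fin n) → Matrix (Fin (d i)) (Fin (d i)) ℂ}
    (hU : ∀ i, U i ∈ Matrix.unitaryGroup (Fin (d i)) ℂ) (i : Fin n)
    (A : Matrix (Fin (d i)) (Fin (d i)) ℂ) :
    tensorMatrix U * embedFactor i A * (tensorMatrix U)ᴴ = embedFactor i (U i * A * (U i)ᴴ) := by
  rw [tensorMatrix_conjTranspose, embedFactor, embedFactor, tensorMatrix_mul, tensorMatrix_mul]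
  congr 1
  ext1 j
  obtain rfl | h := eq_or_ne j i
  · simp
  -- Away from factor `i` only `U j * (U j)ᴴ = 1` remains.
  · simpa [h, Matrix.star_eq_conjTranspose] using Matrix.mem_unitaryGroup_iff.1 (hU j)

end Tensor

theorem mainTheorem3 (n : ℕ) (d : Fin n → ℕ)
    (C : (i : Fin n) → Matrix (Fin (d i)) (Fin (d i)) ℂ) :
    WeaklySubmajorizedBy
      (singularValueVector (∑ i, embedFactor i (C i)))
      (singularValueVector (∑ i, matrixAbs (embedFactor i (C i)))) := by
  intro k _
  rw [decreasingRearrangement_singularValueVector, decreasingRearrangement_singularValueVector]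
  choose U hU hC using fun i => exists_unitary_eq_mul_matrixAbs (C i)
  have hC' : ∀ i, embedFactor i (C i) = embedFactor i (U i) * embedFactor i (matrixAbs (C i)) :=
    fun i => by rw [← embedFactor_mul, ← hC]
  have hUU : tensorMatrix U * (tensorMatrix U)ᴴ = 1 := by
    rw [tensorMatrix_conjTranspose, tensorMatrix_mul, ← tensorMatrix_one]
    congr 1
    ext1 i
    exact Matrix.mem_unitaryGroup_iff.1 (hU i)
  have key := LinearMap.sum_singularValues_sum_le
    (finrank_euclideanSpace (𝕜 := ℂ) (ι := (i : Fin n) → Fin (d i)))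
    (P := fun i => Matrix.toEuclideanLin (embedFactor i (matrixAbs (C i))))
    (V := fun i => Matrix.toEuclideanLin (embedFactor i (U i)))
    (U := Matrix.toEuclideanLin (tensorMatrix U))
    (fun i => Matrix.isPositive_toEuclideanLin_iff.2
      (embedFactor_posSemidef i (matrixAbs_posSemidef (C i))))
    (by rw [← Matrix.toEuclideanLin_conjTranspose_eq_adjoint, ← Matrix.toLpLin_mul_same, hUU,
          Matrix.toLpLin_one])
    (fun i => by
      simp only [← Matrix.toEuclideanLin_conjTranspose_eq_adjoint, ← Matrix.toLpLin_mul_same]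
      rw [← Matrix.mul_assoc, ← Matrix.mul_assoc, tensorMatrix_mul_embedFactor_mul hU,
        embedFactor_conjTranspose, embedFactor_mul, embedFactor_mul]) k
  simp only [← Matrix.toLpLin_mul_same, ← hC', ← map_sum] at key
  simpa only [singularValueVector, matrixAbs_embedFactor] using key
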